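/- Let $k$ be an infinite field and let $n, m$ be non-negative integers with $n \le m/2$. A coordinate projection of $k^m$ is an endomorphism of $k^m$ that preserves the values of some set $I$ of coordinates and sets the others to zero; it preserves $|I|$ coordinates. A signed coordinate projection is the composition of a coordinate projection with the map given by a diagonal matrix with diagonal entries $\pm 1$. Write $\mathscr{R}_r$ (respectively $\mathscr{S}_r$) for the set of coordinate projections (respectively signed coordinate projections) of $k^m$ that preserve at least $r$ coordinates, and $\mathscr{P}_m$ for the group of permutations of the $m$ coordinates of $k^m$. Let $\operatorname{Gr}(n,m)$ be the Grassmannian of $n$-dimensional $k$-subspaces of $k^m$ with its Zariski topology. Then there is a dense open set $\mathscr{U} \subseteq \operatorname{Gr}(n,m)$ such that the following holds for every $V \in \mathscr{U}$. If $\rho_1\pi_1(v_1) = \rho_2\pi_2(v_2)$ with $v_1, v_2 \in V$, $\rho_1 \in \mathscr{S}_n$, $\rho_2 \in \mathscr{S}_{2n}$ and $\pi_1, \pi_2 \in \mathscr{P}_m$, then $v_1 = v_2$ or $v_1 = -v_2$. Moreover, if $\rho_1 \in \mathscr{R}_n$ and $\rho_2 \in \mathscr{R}_{2n}$, then $v_1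 = v_2$. -/

import Mathlib

/-- The Zariski topology on the affine space `k^σ` (its `k`-points): the sets where a polynomial
does not vanish form a basis of open sets. -/
@[reducible]
def zariskiTopology (k σ : Type*) [Field k] : TopologicalSpace (σ → k) :=
  TopologicalSpace.generateFrom
    {U | ∃ p : MvPolynomial σ k, U = {x | MvPolynomial.eval x p ≠ 0}}

/-- `Gr k n m` is the Grassmannian of `n`-dimensional linear subspaces of `k^m`. -/
@[ext]
structure Gr (k : Type*) [Field k] (n m : ℕ) where
  /-- the subspace -/
  toSubmodule : Submodule k (Fin m → k)
  /-- its dimension is `n` -/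
  finrank_eq : Module.finrank k toSubmodule = n

/-- `n`-frames in `k^m`: linearly independent `n`-tuples of vectors, that is, the `n × m` matrices
of rank `n`. -/
def Frame (k : Type*) [Field k] (n m : ℕ) : Type _ :=
  {A : Fin n → Fin m → k // LinearIndependent k A}

/-- The Zariski topology on frames, as a subspace of the affine space of `n × m` matrices. -/
instance Frame.instTopologicalSpace (k : Type*) [Field k] (n m : ℕ) :
    TopologicalSpace (Frame k n m) :=
  TopologicalSpace.induced (fun (A : Frame k n m) (ij : Fin n × Fin m) => A.1 ij.1 ij.2)
    (zariskiTopology k (Fin n × Fin m))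

/-- The subspace spanned by a frame. -/
def Frame.span {k : Type*} [Field k] {n m : ℕ} (A : Frame k n m) : Gr k n m where
  toSubmodule := Submodule.span k (Set.range A.1)
  finrank_eq := by
    rw [finrank_span_eq_card A.2, Fintype.card_fin]

/-- The Zariski topology on the Grassmannian, as the quotient of the space of frames by the change
of basis: a set of subspaces is open when the set of frames that span its members is open. -/
instance Gr.instTopologicalSpace (k : Type*) [Field k] (n m : ℕ) :
    TopologicalSpace (Gr k n m) :=
  TopologicalSpace.coinduced (Frame.span (k := k) (n := n) (m := m)) inferInstance

/-- The coordinate projection of `k^m` that preserves the coordinates in `I` and sets the rest to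
zero. -/
def coordProj (k : Type*) [Field k] {m : ℕ} (I : Finset (Fin m)) :
    (Fin m → k) →ₗ[k] (Fin m → k) :=
  LinearMap.pi fun i => if i ∈ I then LinearMap.proj i else 0

/-- The coordinate projections of `k^m` that preserve at least `r` coordinates. -/
def coordProjections (k : Type*) [Field k] (m r : ℕ) :
    Set ((Fin m → k) →ₗ[k] (Fin m → k)) :=
  {ρ | ∃ I : Finset (Fin m), r ≤ I.card ∧ ρ = coordProj k I}

/-- The signed coordinate projections of `k^m` that preserve at least `r` coordinates (up to sign):
a coordinate projection composed with a diagonal matrix with diagonal entries `1` or `-1`. -/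
def signedCoordProjections (k : Type*) [Field k] (m r : ℕ) :
    Set ((Fin m → k) →ₗ[k] (Fin m → k)) :=
  {ρ | ∃ I : Finset (Fin m), r ≤ I.card ∧ ∃ s : Fin m → k, (∀ i, s i = 1 ∨ s i = -1) ∧
    ρ = coordProj k I ∘ₗ Matrix.toLin' (Matrix.diagonal s)}

/-- The permutations of the `m` coordinates of `k^m`. -/
def coordPermutations (k : Type*) [Field k] (m : ℕ) :
    Set ((Fin m → k) →ₗ[k] (Fin m → k)) :=
  {π | ∃ σ : Equiv.Perm (Fin m), π = LinearMap.funLeft k k σ}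

open Module

/-! Comparing 2n of the coordinates kept by `ρ₂` turns the hypothesis into equations v₂(a j) = ε_j
v₁(b j) for 2n indices j, with a and b injective and ε_j in {0, 1, -1}. Only finitely many triples
(a, b, ε) occur, so it suffices to treat each one for generic V.

Define F, G : k^{2n} → k^m by F c = ∑ c_j ε_j e_{b j} and G c = ∑ c_j e_{a j}. The equations say
that G c ⬝ v₂ = F c ⬝ v₁ for all c. Two cases arise for the pencil F - μ G.

If some kernel K = ker (F - μ G) has dimension above n, then v₂ - μ v₁ is orthogonal to G(K), and a
generic n-dimensional V meets the orthogonal complement of G(K) only in 0. So v₂ = μ v₁, and by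
`exists_fixed_of_card_lt` so large a K forces μ = 0 or μ = ε_j for some j.

If every kernel has dimension at most n, then `exists_separating_vectors` gives n vectors at which
the 2n × 2n determinant of the system is nonzero. The determinant is then a nonzero polynomial in a
frame of V, and generically v₁ = v₂ = 0.

Thus v₂ is 0 or ± v₁. If v₂ = 0, then v₁ vanishes at n places and is generically 0 too. -/

/-- A property of points of affine space holds generically if it holds wherever some nonzero
polynomial does not vanish. -/
def IsGeneric {k σ : Type*} [Field k] (P : (σ → k) → Prop) : Prop :=
  ∃ f : MvPolynomial σ k, f ≠ 0 ∧ ∀ x, MvPolynomial.eval x f ≠ 0 → P x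

/-! ### Generic properties -/

namespace IsGeneric

variable {k σ : Type*} [Field k]

theorem of_eval_ne_zero (f : MvPolynomial σ k) (x₀ : σ → k) (h : MvPolynomial.eval x₀ f ≠ 0) :
    IsGeneric fun x => MvPolynomial.eval x f ≠ 0 :=
  ⟨f, fun h0 => h (by simp [h0]), fun _ hx => hx⟩

theorem mono {P Q : (σ → k) → Prop} (h : IsGeneric P) (hPQ : ∀ x, P x → Q x) : IsGeneric Q :=
  let ⟨f, hf, hP⟩ := h
  ⟨f, hf, fun x hx => hPQ x (hP x hx)⟩

theorem and {P Q : (σ → k) → Prop} (hP : IsGeneric P) (hQ : IsGeneric Q) :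
    IsGeneric fun x => P x ∧ Q x := by
  obtain ⟨f, hf, hfP⟩ := hP
  obtain ⟨g, hg, hgQ⟩ := hQ
  refine ⟨f * g, mul_ne_zero hf hg, fun x hx => ?_⟩
  rw [map_mul] at hx
  exact ⟨hfP x (left_ne_zero_of_mul hx), hgQ x (right_ne_zero_of_mul hx)⟩

theorem forall_mem {ι : Type*} (s : Finset ι) {P : ι → (σ → k) → Prop}
    (h : ∀ i ∈ s, IsGeneric (P i)) : IsGeneric fun x => ∀ i ∈ s, P i x := by
  classical
  induction s using Finset.induction_on with
  | empty => exact ⟨1, one_ne_zero, by simp⟩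
  | insert i s _ ih =>
    refine ((h i (Finset.mem_insert_self i s)).and
      (ih fun j hj => h j (Finset.mem_insert_of_mem hj))).mono fun x hx => ?_
    simpa using hx

theorem forall_of_finite {ι : Type*} [Finite ι] {P : ι → (σ → k) → Prop}
    (h : ∀ i, IsGeneric (P i)) : IsGeneric fun x => ∀ i, P i x := by
  have := Fintype.ofFinite ι
  exact (forall_mem Finset.univ fun i _ => h i).mono fun x hx i => hx i (Finset.mem_univ i)

theorem exists_point [Infinite k] {P : (σ → k) → Prop} (h : IsGeneric P) : ∃ x, P x := by
  obtain ⟨f, hf, hP⟩ := h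
  by_contra! hne
  exact hf (MvPolynomial.funext fun x => by
    rw [map_zero]
    by_contra hx
    exact hne x (hP x hx))

end IsGeneric

/-! ### Linear forms and separation of vectors -/

/-- The linear form with the given coefficients, as a polynomial. -/
noncomputable def linearForm {k σ : Type*} [Field k] [Fintype σ] (x : σ → k) : MvPolynomial σ k :=
  ∑ i, MvPolynomial.C (x i) * MvPolynomial.X i

@[simp]
theorem eval_linearForm {k σ : Type*} [Field k] [Fintype σ] (x v : σ → k) :
    MvPolynomial.eval v (linearForm x) = x ⬝ᵥ v := by
  simp [linearForm, dotProduct]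

/-- A vector outside the line of `x` is separated from it by some `v` orthogonal to `x`. -/
theorem exists_dotProduct_eq_zero_ne_zero {k σ : Type*} [Field k] [Fintype σ]
    {x y : σ → k} (h : y ∉ Submodule.span k {x}) : ∃ v, x ⬝ᵥ v = 0 ∧ y ⬝ᵥ v ≠ 0 := by
  classical
  obtain ⟨f, hfy, hf⟩ := Submodule.exists_le_ker_of_notMem h
  have key : ∀ z : σ → k, z ⬝ᵥ (fun i => f fun j => if i = j then 1 else 0) = f z := fun z =>
    (LinearMap.pi_apply_eq_sum_univ f z).symm
  refine ⟨fun i => f fun j => if i = j then 1 else 0, ?_, ?_⟩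
  · rw [key]; exact hf (Submodule.mem_span_singleton_self x)
  · rw [key]; exact hfy

/-- Two vectors outside the line of `x` are separated from it simultaneously. -/
theorem exists_dotProduct_eq_zero_ne_zero_ne_zero {k σ : Type*} [Field k] [Fintype σ]
    {x y z : σ → k} (hy : y ∉ Submodule.span k {x}) (hz : z ∉ Submodule.span k {x}) :
    ∃ v, x ⬝ᵥ v = 0 ∧ y ⬝ᵥ v ≠ 0 ∧ z ⬝ᵥ v ≠ 0 := by
  obtain ⟨u, hxu, hyu⟩ := exists_dotProduct_eq_zero_ne_zero hy
  obtain ⟨w, hxw, hzw⟩ := exists_dotProduct_eq_zero_ne_zero hz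
  by_cases hzu : z ⬝ᵥ u = 0
  · by_cases hyw : y ⬝ᵥ w = 0
    · exact ⟨u + w, by simp [dotProduct_add, *], by simp [dotProduct_add, *],
        by simp [dotProduct_add, *]⟩
    · exact ⟨w, hxw, hyw, hzw⟩
  · exact ⟨u, hxu, hyu, hzu⟩

/-! ### Pencils of linear maps -/

section Pencil

variable {k σ W : Type*} [Field k] [AddCommGroup W] [Module k W]
  [FiniteDimensional k W]

/-- A pencil `F - μ G` with `G` injective degenerates for finitely many `μ` only. -/
theorem finite_setOf_ker_sub_smul_ne_bot {F G : W →ₗ[k] (σ → k)} (hG : Function.Injective G) :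
    {μ : k | LinearMap.ker (F - μ • G) ≠ ⊥}.Finite := by
  -- With `P` a left inverse of `G`, a kernel vector of `F - μ • G` is an eigenvector of `P ∘ₗ F`
  -- for `μ`.
  obtain ⟨P, hP⟩ := G.exists_leftInverse_of_injective (LinearMap.ker_eq_bot.2 hG)
  refine (Module.End.finite_hasEigenvalue (P ∘ₗ F)).subset fun μ hμ => ?_
  obtain ⟨c, hc, hc0⟩ := Submodule.exists_mem_ne_zero_of_ne_bot hμ
  refine Module.End.hasEigenvalue_of_hasEigenvector (x := c) ⟨?_, hc0⟩
  rw [Module.End.mem_eigenspace_iff]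
  have h1 : F c = μ • G c := by simpa [sub_eq_zero] using hc
  have h2 : P (G c) = c := by simpa using LinearMap.congr_fun hP c
  simp [h1, h2]

variable [Infinite k]

/-- If every member of the pencil `F - μ G` is nonzero on `C`, then some `F c` with `c ∈ C` is not a
multiple of `G c`. -/
theorem exists_mem_forall_ne_smul {F G : W →ₗ[k] (σ → k)} (hG : Function.Injective G)
    (C : Submodule k W)
    (hC : ∀ μ : k, finrank k ↥(C ⊓ LinearMap.ker (F - μ • G)) < finrank k C) :
    ∃ c ∈ C, F c ∉ Submodule.span k {G c} := by
  classical
  set s := (finite_setOf_ker_sub_smul_ne_bot (F := F) hG).toFinset with hs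
  by_contra! hcon
  have hCpos : 0 < finrank k C := lt_of_le_of_lt (Nat.zero_le _) (hC 0)
  have hproper : ∀ μ : k, (LinearMap.ker (F - μ • G)).comap C.subtype ≠ ⊤ := fun μ h => by
    have := hC μ
    rw [inf_eq_left.2 (Submodule.comap_subtype_eq_top.1 h)] at this
    exact lt_irrefl _ this
  -- Otherwise finitely many proper subspaces cover `C`, which is impossible over an infinite field.
  -- The extra `⊥` takes care of `c = 0`.
  have huniv : ⋃ p ∈ insert ⊥ (s.image fun μ => (LinearMap.ker (F - μ • G)).comap C.subtype),
      (p : Set C) = Set.univ := by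
    refine Set.eq_univ_of_forall fun c => ?_
    by_cases hc : c = 0
    · exact Set.mem_biUnion (Finset.mem_insert_self _ _) (by simp [hc])
    · obtain ⟨μ, hμ⟩ := Submodule.mem_span_singleton.1 (hcon c c.2)
      have hmem : (c : W) ∈ LinearMap.ker (F - μ • G) := by simp [← hμ]
      refine Set.mem_biUnion (Finset.mem_insert_of_mem (Finset.mem_image_of_mem _ ?_)) hmem
      simp only [hs, Set.Finite.mem_toFinset, Set.mem_ofPred_eq]
      intro hbot
      rw [hbot, Submodule.mem_bot] at hmem
      exact hc (by simpa using hmem)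
  refine Subspace.biUnion_ne_univ_of_top_notMem ?_ huniv
  simp only [Finset.mem_insert, Finset.mem_image, not_or, not_exists, not_and]
  refine ⟨fun h => ?_, fun μ _ => hproper μ⟩
  have : finrank k (⊤ : Submodule k C) = 0 := by rw [h]; exact finrank_bot k C
  rw [finrank_top] at this
  omega

/-- If no member of the pencil `F - μ G` on the `2n`-dimensional space `C` has a kernel of dimension
above `n`, then some `n` vectors `v j` detect every nonzero `c ∈ C` by the numbers `F c ⬝ᵥ v j` and
`G c ⬝ᵥ v j`. -/
theorem exists_separating_vectors [Fintype σ] {F G : W →ₗ[k] (σ → k)} (hG : Function.Injective G) (n : ℕ) :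
    ∀ C : Submodule k W, finrank k C = 2 * n →
      (∀ μ : k, finrank k ↥(C ⊓ LinearMap.ker (F - μ • G)) ≤ n) →
      ∃ v : Fin n → σ → k, ∀ c ∈ C, (∀ j, F c ⬝ᵥ v j = 0 ∧ G c ⬝ᵥ v j = 0) → c = 0 := by
  classical
  induction n with
  | zero =>
    intro C hC _
    refine ⟨Fin.elim0, fun c hc _ => ?_⟩
    rw [mul_zero, Submodule.finrank_eq_zero] at hC
    simpa [hC] using hc
  | succ n ih =>
    intro C hC hker
    obtain ⟨c, hcC, hc⟩ := exists_mem_forall_ne_smul (F := F) hG C fun μ => by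
      have := hker μ
      omega
    obtain ⟨c', hc'C, hc'⟩ : ∃ c' ∈ C, c' ∉ Submodule.span k {c} := by
      by_contra! hle
      have h1 := Submodule.finrank_mono (show C ≤ Submodule.span k {c} from hle)
      have h2 := finrank_span_le_card (R := k) {c}
      rw [Set.toFinset_singleton, Finset.card_singleton] at h2
      omega
    have hGc' : G c' ∉ Submodule.span k {G c} := fun h => hc' <| by
      obtain ⟨t, ht⟩ := Submodule.mem_span_singleton.1 h
      exact Submodule.mem_span_singleton.2 ⟨t, hG (by rw [map_smul, ht])⟩
    -- At `v₀` the form of `G c` vanishes and those of `F c` and `G c'` do not, so the 2 × 2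
    -- determinant in `hgen` is a nonzero polynomial.
    obtain ⟨v₀, hx₀, hy₀, hz₀⟩ := exists_dotProduct_eq_zero_ne_zero_ne_zero hc hGc'
    -- One nonzero `d μ` per degenerate kernel: if `v` does not kill `G (d μ)`, passing to `ker ev`
    -- lowers the dimension of that kernel, while `C` loses exactly two dimensions. Both bounds then
    -- fit the induction.
    set s := (finite_setOf_ker_sub_smul_ne_bot (F := F) hG).toFinset with hs
    have hd : ∀ μ : k, ∃ d : W, C ⊓ LinearMap.ker (F - μ • G) ≠ ⊥ →
        d ∈ C ⊓ LinearMap.ker (F - μ • G) ∧ d ≠ 0 := fun μ => by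
      by_cases h : C ⊓ LinearMap.ker (F - μ • G) ≠ ⊥
      · obtain ⟨d, hd, hd0⟩ := Submodule.exists_mem_ne_zero_of_ne_bot h
        exact ⟨d, fun _ => ⟨hd, hd0⟩⟩
      · exact ⟨0, fun h' => absurd h' h⟩
    choose d hd using hd
    have hgen : IsGeneric fun v : σ → k =>
        (F c ⬝ᵥ v) * (G c' ⬝ᵥ v) - (F c' ⬝ᵥ v) * (G c ⬝ᵥ v) ≠ 0 ∧
          ∀ μ ∈ s, C ⊓ LinearMap.ker (F - μ • G) ≠ ⊥ → G (d μ) ⬝ᵥ v ≠ 0 := by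
      refine IsGeneric.and ?_ (IsGeneric.forall_mem s fun μ _ => ?_)
      · have := IsGeneric.of_eval_ne_zero (linearForm (F c) * linearForm (G c') -
          linearForm (F c') * linearForm (G c)) v₀ (by simp [hx₀, hy₀, hz₀])
        simpa using this
      · by_cases h : C ⊓ LinearMap.ker (F - μ • G) ≠ ⊥
        · obtain ⟨w, -, hw⟩ := exists_dotProduct_eq_zero_ne_zero (x := 0) (y := G (d μ)) (by
            rw [Submodule.span_zero_singleton, Submodule.mem_bot]
            exact (map_ne_zero_iff G hG).2 (hd μ h).2)
          have := IsGeneric.of_eval_ne_zero (linearForm (G (d μ))) w (by simpa using hw)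
          exact this.mono fun v hv _ => by simpa using hv
        · exact ⟨1, one_ne_zero, fun v _ h' => absurd h' h⟩
    obtain ⟨v, hQ, hv⟩ := hgen.exists_point
    let ev : W →ₗ[k] k × k :=
      ((dotProductBilin k k).flip v ∘ₗ F).prod ((dotProductBilin k k).flip v ∘ₗ G)
    have hev : ∀ w, ev w = (F w ⬝ᵥ v, G w ⬝ᵥ v) := fun w => rfl
    have hsurj : LinearMap.range (ev ∘ₗ C.subtype) = ⊤ := by
      rw [LinearMap.range_eq_top]
      rintro ⟨p, q⟩
      set D := (F c ⬝ᵥ v) * (G c' ⬝ᵥ v) - (F c' ⬝ᵥ v) * (G c ⬝ᵥ v) with hD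
      -- Cramer's rule.
      refine ⟨(D⁻¹ * (p * (G c' ⬝ᵥ v) - q * (F c' ⬝ᵥ v))) • ⟨c, hcC⟩ +
        (D⁻¹ * (q * (F c ⬝ᵥ v) - p * (G c ⬝ᵥ v))) • ⟨c', hc'C⟩, ?_⟩
      simp only [LinearMap.comp_apply, map_add, map_smul, Submodule.subtype_apply, hev,
        Prod.smul_mk, Prod.mk_add_mk, smul_eq_mul, Prod.mk.injEq]
      constructor <;> field_simp <;> rw [hD] <;> ring
    obtain ⟨u, hu⟩ := ih (C ⊓ LinearMap.ker ev) (by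
        have h1 := LinearMap.finrank_range_add_finrank_ker (ev ∘ₗ C.subtype)
        rw [hsurj, finrank_top, Module.finrank_prod, Module.finrank_self, hC,
          LinearMap.ker_comp] at h1
        rw [← Submodule.map_comap_subtype, LinearEquiv.finrank_eq
          (Submodule.equivMapOfInjective _ C.subtype_injective _).symm]
        omega) (fun μ => by
        by_cases h : C ⊓ LinearMap.ker (F - μ • G) = ⊥
        · have : (C ⊓ LinearMap.ker ev) ⊓ LinearMap.ker (F - μ • G) = ⊥ :=
            eq_bot_iff.2 fun w hw => h ▸ ⟨hw.1.1, hw.2⟩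
          rw [this, finrank_bot]
          exact Nat.zero_le n
        · have hμs : μ ∈ s := by
            simp only [hs, Set.Finite.mem_toFinset, Set.mem_ofPred_eq]
            intro h'
            exact h (by rw [h', inf_bot_eq])
          have hlt : (C ⊓ LinearMap.ker ev) ⊓ LinearMap.ker (F - μ • G) <
              C ⊓ LinearMap.ker (F - μ • G) := by
            refine lt_of_le_of_ne (fun w hw => ⟨hw.1.1, hw.2⟩) fun heq => ?_
            have hmem : d μ ∈ (C ⊓ LinearMap.ker ev) ⊓ LinearMap.ker (F - μ • G) :=
              heq ▸ (hd μ h).1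
            have h0 := hmem.1.2
            rw [SetLike.mem_coe, LinearMap.mem_ker, hev, Prod.mk_eq_zero] at h0
            exact hv μ hμs h h0.2
          have := Submodule.finrank_lt_finrank_of_lt hlt
          have := hker μ
          omega)
    refine ⟨Fin.cons v u, fun w hw h => hu w ⟨hw, ?_⟩ fun j => by simpa using h j.succ⟩
    have := h 0
    rw [SetLike.mem_coe, LinearMap.mem_ker, hev, Prod.mk_eq_zero]
    simpa using this

end Pencil

/-! ### Weighted partial permutations and their eigenvalues -/

/-- The linear map that sends `c` to `∑ j, c j * ε j` times the `b j`-th basis vector. -/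
noncomputable def weightedCoords {k ι σ : Type*} [Field k] [Fintype ι] [DecidableEq σ] (b : ι → σ)
    (ε : ι → k) : (ι → k) →ₗ[k] (σ → k) :=
  Fintype.linearCombination k fun j => ε j • (Pi.single (b j) 1 : σ → k)

section WeightedCoords

variable {k ι σ : Type*} [Field k] [Fintype ι] [DecidableEq σ] {b : ι → σ}

theorem weightedCoords_apply (ε : ι → k) (c : ι → k) (i : σ) :
    weightedCoords b ε c i = ∑ j, if i = b j then c j * ε j else 0 := by
  simp [weightedCoords, Fintype.linearCombination_apply, Finset.sum_apply, Pi.single_apply]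

theorem weightedCoords_apply_self (hb : Function.Injective b) (ε : ι → k) (c : ι → k) (j : ι) :
    weightedCoords b ε c (b j) = c j * ε j := by
  classical
  simp [weightedCoords_apply, hb.eq_iff]

theorem weightedCoords_apply_of_notMem_range (ε : ι → k) (c : ι → k) {i : σ}
    (hi : i ∉ Set.range b) : weightedCoords b ε c i = 0 := by
  rw [weightedCoords_apply]
  exact Finset.sum_eq_zero fun j _ => if_neg fun h => hi ⟨j, h.symm⟩

theorem weightedCoords_dotProduct [Fintype σ] (ε : ι → k) (c : ι → k) (v : σ → k) :
    weightedCoords b ε c ⬝ᵥ v = ∑ j, c j * (ε j * v (b j)) := by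
  simp only [weightedCoords, Fintype.linearCombination_apply, sum_dotProduct, smul_dotProduct,
    single_dotProduct, one_mul, smul_eq_mul]

theorem weightedCoords_one_injective (hb : Function.Injective b) :
    Function.Injective (weightedCoords b (1 : ι → k)) := fun c d h => funext fun j => by
  simpa [weightedCoords_apply_self hb] using congrFun h (b j)

/-- A nonzero eigenvalue `μ` of the pencil of two weighted partial permutations has multiplicity at
most half the number of coordinates, unless a coordinate is fixed with weight `μ`. -/
theorem exists_fixed_of_card_lt {a : ι → σ} (ha : Function.Injective a)
    (hb : Function.Injective b) (ε : ι → k) {μ : k} (hμ : μ ≠ 0)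
    (h : Fintype.card ι <
      2 * finrank k ↥(LinearMap.ker (weightedCoords b ε - μ • weightedCoords a 1))) :
    ∃ j, a j = b j ∧ ε j = μ := by
  classical
  by_contra! hfix
  set N := LinearMap.ker (weightedCoords b ε - μ • weightedCoords a 1) with hN
  -- The coordinate functionals on the kernel: the kernel equation makes each `φ j` either zero or
  -- proportional to `φ i`, where `b i = a j`.
  let φ : ι → Dual k N := fun j => LinearMap.proj j ∘ₗ N.subtype
  have hφ : ∀ j (c : N), φ j c = c.1 j := fun j c => rfl
  have hrel : ∀ j (c : N), weightedCoords b ε c.1 (a j) = μ * c.1 j := fun j c => by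
    have h0 : weightedCoords b ε c.1 - μ • weightedCoords a 1 c.1 = 0 := LinearMap.mem_ker.1 c.2
    have := congrFun (sub_eq_zero.1 h0) (a j)
    rwa [Pi.smul_apply, weightedCoords_apply_self ha, Pi.one_apply, mul_one,
      smul_eq_mul] at this
  have hzero : ∀ j, a j ∉ Set.range b → φ j = 0 := fun j hj => by
    ext c
    have := hrel j c
    rw [weightedCoords_apply_of_notMem_range _ _ hj] at this
    exact (mul_eq_zero.1 this.symm).resolve_left hμ
  have hstep : ∀ j i, b i = a j → μ • φ j = ε i • φ i := fun j i hij => by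
    ext c
    have := hrel j c
    rw [← hij, weightedCoords_apply_self hb] at this
    simp only [LinearMap.smul_apply, hφ, smul_eq_mul, ← this, mul_comm]
  -- The `φ j` separate points of `N`, so a maximal independent subfamily has at least `finrank k N`
  -- members. Each member `e r` has a partner `π r` with proportional functional; the indices `e r`
  -- and `π r` are shown to be all distinct, whence twice the dimension is at most `card ι`.
  obtain ⟨κ, e, he, hspan, hli⟩ := exists_linearIndependent' k φ
  have := Fintype.ofInjective e he
  have hcard : finrank k N ≤ Fintype.card κ := by
    rw [← Module.finrank_fintype_fun_eq_card k]
    refine LinearMap.finrank_le_finrank_of_injective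
      (f := LinearMap.pi fun r => φ (e r)) ?_
    rw [← LinearMap.ker_eq_bot, eq_bot_iff]
    intro c hc
    have hle : Submodule.span k (Set.range (φ ∘ e)) ≤ LinearMap.ker (Dual.eval k N c) := by
      rw [Submodule.span_le]
      rintro _ ⟨r, rfl⟩
      exact congrFun (LinearMap.mem_ker.1 hc) r
    rw [Submodule.mem_bot]
    refine Subtype.ext (funext fun j => ?_)
    have hj : φ j ∈ Submodule.span k (Set.range (φ ∘ e)) :=
      hspan.symm ▸ Submodule.subset_span (Set.mem_range_self j)
    exact hle hj
  have hne : ∀ r, φ (e r) ≠ 0 := fun r => hli.ne_zero r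
  have hπ : ∀ r, ∃ i, b i = a (e r) := fun r => by
    by_contra hr
    exact hne r (hzero _ hr)
  choose π hπ using hπ
  have hdisj : ∀ r s, e r ≠ π s := fun r s hrs => by
    have h1 := hstep _ _ (hπ s)
    -- If `r = s`, the index is its own partner: a fixed coordinate of weight `μ`. If `r ≠ s`, two
    -- independent functionals would be proportional.
    by_cases hs : r = s
    · subst hs
      rw [← hrs] at h1
      refine hfix (e r) ?_ ?_
      · rw [← hπ r, hrs]
      · exact (smul_left_injective k (hne r) h1).symm
    · rw [← hrs] at h1
      have h2 : Finsupp.single s μ = Finsupp.single r (ε (e r)) := hli (by simpa using h1)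
      exact hμ (by simpa [Finsupp.single_apply, hs] using DFunLike.congr_fun h2 s)
  have hinj : Function.Injective (Sum.elim e π) := by
    refine he.sumElim (fun r s hrs => he (ha ?_)) hdisj
    rw [← hπ r, ← hπ s, hrs]
  have := Fintype.card_le_of_injective _ hinj
  rw [Fintype.card_sum] at this
  omega

end WeightedCoords

/-! ### Generic row spaces -/

/-- The span of the rows of a matrix. -/
def rowSpan {k τ σ : Type*} [Field k] (x : τ × σ → k) : Submodule k (σ → k) :=
  Submodule.span k (Set.range fun i j => x (i, j))

section Generic

variable {k τ σ : Type*} [Field k] [Fintype τ]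

theorem mem_rowSpan {x : τ × σ → k} {v : σ → k} :
    v ∈ rowSpan x ↔ ∃ t : τ → k, ∀ s, v s = ∑ i, t i * x (i, s) := by
  rw [rowSpan, Submodule.mem_span_range_iff_exists_fun]
  simp only [funext_iff, Finset.sum_apply, Pi.smul_apply, smul_eq_mul, eq_comm]

variable [Fintype σ]

/-- A left inverse of the combination map of `g` supplies the rows. They are the point at which the
determinant of pairings takes the value 1, hence is a nonzero polynomial. -/
theorem exists_dual_family [DecidableEq τ] {g : τ → σ → k} (hg : LinearIndependent k g) :
    ∃ x : τ × σ → k, ∀ i j, ∑ s, x (i, s) * g j s = (1 : Matrix τ τ k) i j := by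
  classical
  obtain ⟨P, hP⟩ := (Fintype.linearCombination k g).exists_leftInverse_of_injective
    (LinearMap.ker_eq_bot.2 hg.fintypeLinearCombination_injective)
  refine ⟨fun p => P (fun j => if p.2 = j then 1 else 0) p.1, fun i j => ?_⟩
  have h1 := congrFun (LinearMap.congr_fun hP (Pi.single j 1)) i
  rw [LinearMap.comp_apply, Fintype.linearCombination_apply_single, one_smul,
    LinearMap.pi_apply_eq_sum_univ] at h1
  simpa [Finset.sum_apply, mul_comm, Matrix.one_apply, Pi.single_apply] using h1

/-- Generically, no nontrivial combination of the rows of a matrix is orthogonal to a given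
independent family of the same size. -/
theorem isGeneric_eq_zero_of_orthogonal {g : τ → σ → k} (hg : LinearIndependent k g) :
    IsGeneric fun x : τ × σ → k =>
      ∀ t : τ → k, (∀ j, ∑ s, g j s * ∑ i, t i * x (i, s) = 0) → t = 0 := by
  classical
  let M : Matrix τ τ (MvPolynomial (τ × σ) k) :=
    Matrix.of fun i j => ∑ s, MvPolynomial.X (i, s) * MvPolynomial.C (g j s)
  have hM : ∀ x, MvPolynomial.eval x M.det =
      (Matrix.of fun i j => ∑ s, x (i, s) * g j s).det := fun x => by
    rw [RingHom.map_det]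
    congr 1
    ext i j
    simp [M]
  obtain ⟨x₀, hx₀⟩ := exists_dual_family hg
  refine (IsGeneric.of_eval_ne_zero M.det x₀ ?_).mono fun x hx t ht => ?_
  · rw [hM, show (Matrix.of fun i j => ∑ s, x₀ (i, s) * g j s) = 1 from
      Matrix.ext fun i j => hx₀ i j, Matrix.det_one]
    exact one_ne_zero
  · rw [hM] at hx
    refine Matrix.eq_zero_of_vecMul_eq_zero hx <| funext fun j => ?_
    rw [Pi.zero_apply, ← ht j]
    simp only [Matrix.vecMul, dotProduct, Matrix.of_apply, Finset.mul_sum]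
    rw [Finset.sum_comm]
    exact Finset.sum_congr rfl fun _ _ => Finset.sum_congr rfl fun _ _ => by ring

/-- A generic subspace of dimension `n` meets the common kernel of `n` independent linear forms
trivially. -/
theorem isGeneric_orthogonal {g : τ → σ → k} (hg : LinearIndependent k g) :
    IsGeneric fun x : τ × σ → k =>
      ∀ v ∈ rowSpan x, (∀ j, g j ⬝ᵥ v = 0) → v = 0 :=
  (isGeneric_eq_zero_of_orthogonal hg).mono fun x hx v hv hgv => by
    obtain ⟨t, ht⟩ := mem_rowSpan.1 hv
    have ht0 : t = 0 := hx t fun j => by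
      simpa only [dotProduct, ht] using hgv j
    ext s
    simp [ht, ht0]

/-- A vanishing combination of rows is orthogonal to everything, in particular to `g`; the family
`g` only certifies that the ambient space is large enough. -/
theorem isGeneric_linearIndependent {g : τ → σ → k} (hg : LinearIndependent k g) :
    IsGeneric fun x : τ × σ → k => LinearIndependent k fun i j => x (i, j) :=
  (isGeneric_eq_zero_of_orthogonal hg).mono fun x hx =>
    Fintype.linearIndependent_iff.2 fun t ht => congrFun <| hx t fun j =>
      Finset.sum_eq_zero fun s _ => by
        have := congrFun ht s
        rw [Finset.sum_apply] at this
        rw [show ∑ i, t i * x (i, s) = 0 from this, mul_zero]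

/-- For a generic subspace `V` of dimension `n`, two vectors of `V` whose coordinates agree in `2n`
places up to a permutation and weights `ε j` are multiples of each other. -/
theorem isGeneric_eq_zero_or_eq_smul [DecidableEq σ] [Infinite k] {n : ℕ}
    {a b : Fin n ⊕ Fin n → σ} (ha : Function.Injective a) (hb : Function.Injective b)
    (ε : Fin n ⊕ Fin n → k) :
    IsGeneric fun x : Fin n × σ → k => ∀ v₁ ∈ rowSpan x, ∀ v₂ ∈ rowSpan x,
      (∀ j, v₂ (a j) = ε j * v₁ (b j)) → v₂ = 0 ∨ ∃ j, v₂ = ε j • v₁ := by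
  set F := weightedCoords b ε with hF
  set G := weightedCoords a (1 : Fin n ⊕ Fin n → k) with hGdef
  have hG : Function.Injective G := weightedCoords_one_injective ha
  by_cases hμ : ∃ μ : k, n < finrank k ↥(LinearMap.ker (F - μ • G))
  · obtain ⟨μ, hμ⟩ := hμ
    obtain ⟨c, hc⟩ := exists_linearIndependent_of_le_finrank hμ.le
    have hg : LinearIndependent k fun j => G (c j).1 :=
      (hc.map' (Submodule.subtype _) (Submodule.ker_subtype _)).map' G (LinearMap.ker_eq_bot.2 hG)
    refine (isGeneric_orthogonal hg).mono fun x hx v₁ hv₁ v₂ hv₂ h => ?_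
    have hv : v₂ = μ • v₁ := by
      refine sub_eq_zero.1 (hx _ (sub_mem hv₂ (Submodule.smul_mem _ μ hv₁)) fun j => ?_)
      have hcj : F (c j).1 = μ • G (c j).1 :=
        sub_eq_zero.1 (LinearMap.mem_ker.1 (c j).2)
      rw [dotProduct_sub, dotProduct_smul, ← smul_dotProduct, ← hcj, sub_eq_zero]
      refine (weightedCoords_dotProduct _ _ _).trans
        (Eq.trans ?_ (weightedCoords_dotProduct _ _ _).symm)
      exact Finset.sum_congr rfl fun i _ => by rw [h i, Pi.one_apply, one_mul]
    by_cases h0 : μ = 0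
    · left
      rw [hv, h0, zero_smul]
    · obtain ⟨j, -, hj⟩ := exists_fixed_of_card_lt ha hb ε h0 (by
        rw [Fintype.card_sum, Fintype.card_fin, ← two_mul]
        exact Nat.mul_lt_mul_of_pos_left hμ two_pos)
      exact Or.inr ⟨j, hj ▸ hv⟩
  · push Not at hμ
    obtain ⟨w, hw⟩ := exists_separating_vectors (F := F) hG n ⊤
      (by rw [finrank_top, Module.finrank_fintype_fun_eq_card, Fintype.card_sum, Fintype.card_fin,
        two_mul])
      (fun μ => by rw [top_inf_eq]; exact hμ μ)
    -- Evaluated at `w`, this matrix sends `c` to the numbers `F c ⬝ᵥ w i` and `G c ⬝ᵥ w i`, so it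
    -- is injective there.
    let M : Matrix (Fin n ⊕ Fin n) (Fin n ⊕ Fin n) (MvPolynomial (Fin n × σ) k) :=
      Matrix.of fun r j => Sum.elim (fun i => MvPolynomial.C (ε j) * MvPolynomial.X (i, b j))
        (fun i => MvPolynomial.X (i, a j)) r
    let Mx : (Fin n × σ → k) → Matrix (Fin n ⊕ Fin n) (Fin n ⊕ Fin n) k := fun x =>
      Matrix.of fun r j => Sum.elim (fun i => ε j * x (i, b j)) (fun i => x (i, a j)) r
    have hM : ∀ x, MvPolynomial.eval x M.det = (Mx x).det := fun x => by
      rw [RingHom.map_det]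
      congr 1
      ext (i | i) j <;> simp [M, Mx]
    refine (IsGeneric.of_eval_ne_zero M.det (fun p => w p.1 p.2) ?_).mono
      fun x hx v₁ hv₁ v₂ hv₂ h => Or.inl ?_
    · rw [hM]
      intro hdet
      obtain ⟨c, hc0, hc⟩ := Matrix.exists_mulVec_eq_zero_iff.2 hdet
      refine hc0 (hw c Submodule.mem_top fun i => ⟨?_, ?_⟩)
      · rw [hF, weightedCoords_dotProduct]
        refine Eq.trans ?_ (congrFun hc (Sum.inl i))
        exact Finset.sum_congr rfl fun j _ => mul_comm _ _
      · rw [hGdef, weightedCoords_dotProduct]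
        refine Eq.trans ?_ (congrFun hc (Sum.inr i))
        exact Finset.sum_congr rfl fun j _ => by
          rw [Pi.one_apply, one_mul]
          exact mul_comm _ _
    · rw [hM] at hx
      obtain ⟨t₁, ht₁⟩ := mem_rowSpan.1 hv₁
      obtain ⟨t₂, ht₂⟩ := mem_rowSpan.1 hv₂
      -- The hypothesis `h` says that the coefficients of `-v₁` and `v₂` form a left null vector of
      -- the matrix.
      have ht : Sum.elim (-t₁) t₂ = 0 := Matrix.eq_zero_of_vecMul_eq_zero hx <| funext fun j => by
        have := h j
        rw [ht₁, ht₂, Finset.mul_sum] at this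
        simp only [Matrix.vecMul, dotProduct, Mx, Fintype.sum_sum_type, Sum.elim_inl, Sum.elim_inr,
          Matrix.of_apply, this, Pi.neg_apply, Pi.zero_apply, ← Finset.sum_add_distrib]
        exact Finset.sum_eq_zero fun _ _ => by ring
      ext s
      rw [ht₂, Pi.zero_apply]
      exact Finset.sum_eq_zero fun i _ => by
        rw [show t₂ i = 0 from congrFun ht (Sum.inr i), zero_mul]

end Generic

/-! ### Zariski topology on affine space, frames and the Grassmannian -/

section Zariski

variable {k σ : Type*} [Field k]

/-- A Zariski open set contains the nonvanishing set of a polynomial around each of its points. -/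
theorem exists_eval_ne_zero_of_isOpen_zariski {W : Set (σ → k)}
    (hW : @IsOpen _ (zariskiTopology k σ) W) {x : σ → k} (hx : x ∈ W) :
    ∃ p : MvPolynomial σ k, MvPolynomial.eval x p ≠ 0 ∧ {y | MvPolynomial.eval y p ≠ 0} ⊆ W := by
  induction hW with
  | basic s hs =>
    obtain ⟨p, rfl⟩ := hs
    exact ⟨p, hx, subset_rfl⟩
  | univ => exact ⟨1, by simp, Set.subset_univ _⟩
  | inter s t _ _ ihs iht =>
    obtain ⟨p, hp, hps⟩ := ihs hx.1
    obtain ⟨q, hq, hqt⟩ := iht hx.2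
    refine ⟨p * q, by simpa using ⟨hp, hq⟩, fun y hy => ?_⟩
    rw [Set.mem_ofPred_eq, map_mul] at hy
    exact ⟨hps (left_ne_zero_of_mul hy), hqt (right_ne_zero_of_mul hy)⟩
  | sUnion S _ ih =>
    obtain ⟨s, hs, hxs⟩ := hx
    obtain ⟨p, hp, hps⟩ := ih s hs hxs
    exact ⟨p, hp, hps.trans (Set.subset_sUnion_of_mem hs)⟩

end Zariski

section Frames

variable {k : Type*} [Field k] {n m : ℕ}

/-- The entries of a frame as a point of affine space. -/
def Frame.entries (A : Frame k n m) : Fin n × Fin m → k := fun p => A.1 p.1 p.2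

theorem Frame.span_toSubmodule (A : Frame k n m) : A.span.toSubmodule = rowSpan A.entries := rfl

theorem Frame.isOpen_eval_ne_zero (p : MvPolynomial (Fin n × Fin m) k) :
    IsOpen {A : Frame k n m | MvPolynomial.eval A.entries p ≠ 0} :=
  @isOpen_induced _ _ (zariskiTopology k (Fin n × Fin m)) _ _
    (TopologicalSpace.isOpen_generateFrom_of_mem ⟨p, rfl⟩)

/-- The subspaces that have a frame at which the polynomial `f` does not vanish. -/
def Gr.nonvanishing (f : MvPolynomial (Fin n × Fin m) k) : Set (Gr k n m) :=
  {V | ∃ A : Frame k n m, A.span = V ∧ MvPolynomial.eval A.entries f ≠ 0}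

/-- The good frame `B` of a subspace need not be the given frame `A`, but `B = g A` with `g`
invertible. Wherever `f (g x)` does not vanish, `g x` is a good frame of the span of `x`, so these
frames form an open neighbourhood of `A`. -/
theorem Gr.isOpen_nonvanishing (f : MvPolynomial (Fin n × Fin m) k) :
    IsOpen (Gr.nonvanishing f) := by
  rw [isOpen_coinduced, isOpen_iff_forall_mem_open]
  rintro A ⟨B, hBA, hB⟩
  have hmem : ∀ i, B.1 i ∈ rowSpan A.entries := fun i => by
    rw [← A.span_toSubmodule, ← hBA]
    exact Submodule.subset_span ⟨i, rfl⟩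
  choose g hg using fun i => mem_rowSpan.1 (hmem i)
  have hunit : IsUnit (Matrix.of g) := by
    rw [← Matrix.linearIndependent_rows_iff_isUnit, Fintype.linearIndependent_iff]
    intro t ht
    refine Fintype.linearIndependent_iff.1 B.2 t (funext fun s => ?_)
    have : ∀ l, ∑ i, t i * g i l = 0 := fun l => by
      simpa [Finset.sum_apply] using congrFun ht l
    simp only [Finset.sum_apply, Pi.smul_apply, smul_eq_mul, hg, Finset.mul_sum, Pi.zero_apply]
    rw [Finset.sum_comm]
    exact Finset.sum_eq_zero fun l _ => by
      simp only [← mul_assoc, ← Finset.sum_mul, this, zero_mul]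
  have hinv : (Matrix.of g)⁻¹ * Matrix.of g = 1 :=
    Matrix.nonsing_inv_mul _ ((Matrix.isUnit_iff_isUnit_det _).1 hunit)
  let T : (Fin n × Fin m → k) → Fin n × Fin m → k := fun x p => ∑ l, g p.1 l * x (l, p.2)
  let q : MvPolynomial (Fin n × Fin m) k :=
    MvPolynomial.bind₁ (fun p => ∑ l, MvPolynomial.C (g p.1 l) * MvPolynomial.X (l, p.2)) f
  have hq : ∀ x, MvPolynomial.eval x q = MvPolynomial.eval (T x) f := fun x => by
    simp only [q, MvPolynomial.eval, MvPolynomial.eval₂Hom_bind₁]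
    congr 2
    funext p
    simp [T]
  refine ⟨{A' | MvPolynomial.eval A'.entries q ≠ 0}, fun A' hA' => ?_,
    Frame.isOpen_eval_ne_zero q, ?_⟩
  · have hspan : rowSpan (T A'.entries) = rowSpan A'.entries := by
      refine le_antisymm (Submodule.span_le.2 ?_) (Submodule.span_le.2 ?_)
      · rintro _ ⟨i, rfl⟩
        exact mem_rowSpan.2 ⟨g i, fun s => rfl⟩
      · rintro _ ⟨i, rfl⟩
        refine mem_rowSpan.2 ⟨fun l => (Matrix.of g)⁻¹ i l, fun s => ?_⟩
        have : ((Matrix.of g)⁻¹ * (Matrix.of g * Matrix.of fun l s => A'.entries (l, s))) i s =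
            A'.entries (i, s) := by
          rw [← Matrix.mul_assoc, hinv, Matrix.one_mul, Matrix.of_apply]
        exact this.symm
    have hli : LinearIndependent k fun i s => T A'.entries (i, s) := by
      rw [linearIndependent_iff_card_eq_finrank_span, Fintype.card_fin]
      have h1 := A'.span.finrank_eq
      rw [A'.span_toSubmodule, ← hspan] at h1
      exact h1.symm
    refine ⟨⟨fun i s => T A'.entries (i, s), hli⟩, Gr.ext hspan, ?_⟩
    rw [Set.mem_ofPred_eq, hq] at hA'
    exact hA'
  · rw [Set.mem_ofPred_eq, hq, show T A.entries = B.entries from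
      funext fun p => (hg p.1 p.2).symm]
    exact hB

/-- A nonempty open set pulls back to frames and contains a nonempty basic open set there; its
polynomial, `f` and a full-rank condition are compatible because finitely many generic conditions
have a common point. -/
theorem Gr.dense_nonvanishing [Infinite k] {f : MvPolynomial (Fin n × Fin m) k} (hf : f ≠ 0)
    (hnm : n ≤ m) : Dense (Gr.nonvanishing f) := by
  rw [dense_iff_inter_open]
  rintro O hO ⟨V, hV⟩
  obtain ⟨A, rfl⟩ : ∃ A : Frame k n m, A.span = V := by
    have b := Module.finBasisOfFinrankEq k V.toSubmodule V.finrank_eq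
    refine ⟨⟨fun i => b i, b.linearIndependent.map' V.toSubmodule.subtype
      (Submodule.ker_subtype _)⟩, Gr.ext ?_⟩
    have := congrArg (Submodule.map V.toSubmodule.subtype) b.span_eq
    rwa [Submodule.map_span, Submodule.map_subtype_top, ← Set.range_comp] at this
  obtain ⟨W, hW, hWO⟩ := isOpen_coinduced.1 hO
  obtain ⟨p, hp, hpW⟩ := exists_eval_ne_zero_of_isOpen_zariski hW (x := A.entries)
    (show A ∈ _ ⁻¹' W from hWO ▸ hV)
  have hg : LinearIndependent k fun i : Fin n => (Pi.single (Fin.castLE hnm i) 1 : Fin m → k) :=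
    (Pi.linearIndependent_single_one (Fin m) k).comp _ (Fin.castLE_injective hnm)
  obtain ⟨x, ⟨hx1, hx2⟩, hx3⟩ := (((IsGeneric.of_eval_ne_zero p _ hp).and
    ⟨f, hf, fun _ h => h⟩).and (isGeneric_linearIndependent hg)).exists_point
  refine ⟨Frame.span ⟨fun i j => x (i, j), hx3⟩, ?_, ⟨_, rfl, hx2⟩⟩
  have : (⟨fun i j => x (i, j), hx3⟩ : Frame k n m) ∈ Frame.span ⁻¹' O := hWO ▸ hpW hx1
  exact this

end Frames

/-! ### From signed projections to weighted coordinates -/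

section Projections

variable {k : Type*} [Field k] {n m : ℕ}

theorem coordProj_apply (I : Finset (Fin m)) (v : Fin m → k) (j : Fin m) :
    coordProj k I v j = if j ∈ I then v j else 0 := by
  by_cases h : j ∈ I <;> simp [coordProj, h]

/-- Two vectors of `V` with equal images under signed permuted coordinate projections agree up to
sign, and a sign can occur only if the two sign patterns differ. -/
theorem eq_or_eq_neg_of_signed_eq {V : Submodule k (Fin m → k)}
    (hV₁ : ∀ g : Fin n ↪ Fin m, ∀ v ∈ V, (∀ j, v (g j) = 0) → v = 0)
    (hV₂ : ∀ (a b : Fin n ⊕ Fin n ↪ Fin m) (e : Fin n ⊕ Fin n → SignType), ∀ v₁ ∈ V, ∀ v₂ ∈ V,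
      (∀ j, v₂ (a j) = (e j : k) * v₁ (b j)) → v₂ = 0 ∨ ∃ j, v₂ = (e j : k) • v₁)
    {I₁ I₂ : Finset (Fin m)} (hI₁ : n ≤ I₁.card) (hI₂ : 2 * n ≤ I₂.card)
    {s₁ s₂ : Fin m → k} (hs₁ : ∀ i, s₁ i = 1 ∨ s₁ i = -1) (hs₂ : ∀ i, s₂ i = 1 ∨ s₂ i = -1)
    (τ₁ τ₂ : Equiv.Perm (Fin m)) {v₁ v₂ : Fin m → k} (hv₁ : v₁ ∈ V) (hv₂ : v₂ ∈ V)
    (h : ∀ j, (if j ∈ I₁ then s₁ j * v₁ (τ₁ j) else 0) =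
      if j ∈ I₂ then s₂ j * v₂ (τ₂ j) else 0) :
    v₁ = v₂ ∨ v₁ = -v₂ ∧ s₁ ≠ s₂ := by
  classical
  have hne : ∀ {s : Fin m → k}, (∀ i, s i = 1 ∨ s i = -1) → ∀ i, s i ≠ 0 := fun hs i => by
    rcases hs i with h | h <;> simp [h]
  have hzero : v₂ = 0 → v₁ = v₂ := fun h0 => by
    obtain ⟨g⟩ : Nonempty (Fin n ↪ I₁) := Function.Embedding.nonempty_of_card_le (by simpa)
    rw [h0]
    refine hV₁ (g.trans ((Function.Embedding.subtype _).trans τ₁.toEmbedding)) v₁ hv₁ fun j => ?_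
    have := h (g j)
    rw [if_pos (g j).2, h0] at this
    exact (mul_eq_zero.1 (by simpa using this)).resolve_left (hne hs₁ _)
  obtain ⟨g⟩ : Nonempty (Fin n ⊕ Fin n ↪ I₂) :=
    Function.Embedding.nonempty_of_card_le (by simpa [two_mul] using hI₂)
  -- The weight is the ratio of the two signs, and 0 at places outside `I₁`, where `v₂` must vanish.
  let e : Fin n ⊕ Fin n → SignType := fun j =>
    if (g j : Fin m) ∈ I₁ then if s₁ (g j) = s₂ (g j) then 1 else -1 else 0
  have he : ∀ j, v₂ (τ₂ (g j)) = (e j : k) * v₁ (τ₁ (g j)) := fun j => by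
    have hj := h (g j)
    rw [if_pos (g j).2] at hj
    by_cases hI : (g j : Fin m) ∈ I₁
    · rw [if_pos hI] at hj
      by_cases hs : s₁ (g j) = s₂ (g j)
      · rw [hs] at hj
        simp [e, hI, hs, mul_left_cancel₀ (hne hs₂ _) hj]
      · have hneg : s₁ (g j) = -s₂ (g j) := by
          rcases hs₁ (g j) with h1 | h1 <;> rcases hs₂ (g j) with h2 | h2 <;> rw [h1, h2] at hs ⊢
          all_goals first | exact absurd rfl hs | simp
        rw [hneg, neg_mul, ← mul_neg] at hj
        simp [e, hI, hs, ← mul_left_cancel₀ (hne hs₂ _) hj]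
    · rw [if_neg hI] at hj
      simp [e, hI, (mul_eq_zero.1 hj.symm).resolve_left (hne hs₂ _)]
  rcases hV₂ (g.trans ((Function.Embedding.subtype _).trans τ₂.toEmbedding))
    (g.trans ((Function.Embedding.subtype _).trans τ₁.toEmbedding)) e v₁ hv₁ v₂ hv₂ he with
    h0 | ⟨j, hj⟩
  · exact Or.inl (hzero h0)
  · by_cases hI : (g j : Fin m) ∈ I₁
    · by_cases hs : s₁ (g j) = s₂ (g j)
      · left
        simpa [e, hI, hs] using hj.symm
      · right
        refine ⟨?_, fun h => hs (congrFun h _)⟩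
        rw [hj]
        simp [e, hI, hs]
    · exact Or.inl (hzero (by simpa [e, hI] using hj))

end Projections

theorem corollary1 {k : Type*} [Field k] [Infinite k] (n m : ℕ) (hnm : 2 * n ≤ m) :
    ∃ U : Set (Gr k n m), IsOpen U ∧ Dense U ∧ ∀ V ∈ U,
      (∀ ρ₁ ∈ signedCoordProjections k m n, ∀ ρ₂ ∈ signedCoordProjections k m (2 * n),
        ∀ π₁ ∈ coordPermutations k m, ∀ π₂ ∈ coordPermutations k m,
        ∀ v₁ ∈ V.toSubmodule, ∀ v₂ ∈ V.toSubmodule,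
          ρ₁ (π₁ v₁) = ρ₂ (π₂ v₂) → v₁ = v₂ ∨ v₁ = -v₂) ∧
      (∀ ρ₁ ∈ coordProjections k m n, ∀ ρ₂ ∈ coordProjections k m (2 * n),
        ∀ π₁ ∈ coordPermutations k m, ∀ π₂ ∈ coordPermutations k m,
        ∀ v₁ ∈ V.toSubmodule, ∀ v₂ ∈ V.toSubmodule,
          ρ₁ (π₁ v₁) = ρ₂ (π₂ v₂) → v₁ = v₂) := by
  have h₁ : IsGeneric fun x : Fin n × Fin m → k =>
      ∀ g : Fin n ↪ Fin m, ∀ v ∈ rowSpan x, (∀ j, v (g j) = 0) → v = 0 :=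
    IsGeneric.forall_of_finite fun g =>
      (isGeneric_orthogonal ((Pi.linearIndependent_single_one (Fin m) k).comp g g.injective)).mono
        fun x hx v hv h => hx v hv fun j => by simpa using h j
  have h₂ : IsGeneric fun x : Fin n × Fin m → k =>
      ∀ (a b : Fin n ⊕ Fin n ↪ Fin m) (e : Fin n ⊕ Fin n → SignType),
        ∀ v₁ ∈ rowSpan x, ∀ v₂ ∈ rowSpan x,
          (∀ j, v₂ (a j) = (e j : k) * v₁ (b j)) → v₂ = 0 ∨ ∃ j, v₂ = (e j : k) • v₁ :=
    -- Weights in the finite type `SignType` keep the number of conditions finite.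
    IsGeneric.forall_of_finite fun a => IsGeneric.forall_of_finite fun b =>
      IsGeneric.forall_of_finite fun e =>
        isGeneric_eq_zero_or_eq_smul a.injective b.injective fun j => (e j : k)
  obtain ⟨f, hf, hfP⟩ := h₁.and h₂
  refine ⟨Gr.nonvanishing f, Gr.isOpen_nonvanishing f, Gr.dense_nonvanishing hf (by omega), ?_⟩
  rintro _ ⟨A, rfl, hA⟩
  obtain ⟨hV₁, hV₂⟩ := hfP _ hA
  rw [← A.span_toSubmodule] at hV₁ hV₂
  constructor
  · rintro _ ⟨I₁, hI₁, s₁, hs₁, rfl⟩ _ ⟨I₂, hI₂, s₂, hs₂, rfl⟩ _ ⟨τ₁, rfl⟩ _ ⟨τ₂, rfl⟩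
      v₁ hv₁ v₂ hv₂ h
    refine (eq_or_eq_neg_of_signed_eq hV₁ hV₂ hI₁ hI₂ hs₁ hs₂ τ₁ τ₂ hv₁ hv₂ fun j => ?_).imp_right
      And.left
    simpa [coordProj_apply, Matrix.mulVec_diagonal] using congrFun h j
  · rintro _ ⟨I₁, hI₁, rfl⟩ _ ⟨I₂, hI₂, rfl⟩ _ ⟨τ₁, rfl⟩ _ ⟨τ₂, rfl⟩ v₁ hv₁ v₂ hv₂ h
    -- Unsigned projections have equal sign patterns, which rules out the minus sign.
    refine (eq_or_eq_neg_of_signed_eq hV₁ hV₂ hI₁ hI₂ (s₁ := 1) (s₂ := 1) (fun _ => Or.inl rfl)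
      (fun _ => Or.inl rfl) τ₁ τ₂ hv₁ hv₂ fun j => ?_).resolve_right fun h => h.2 rfl
    simpa [coordProj_apply] using congrFun h j
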